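/- Let $(Z,\mathcal T)$ be a topological space. For a sequence $(K_n)_{n\in\omega}$ of subsets of a space $X$ let $\mathrm{Li}(K_n)$ (respectively $\mathrm{Ls}(K_n)$) be the set of all $x\in X$ such that every neighbourhood of $x$ meets $K_n$ for all but finitely many $n$ (respectively for infinitely many $n$). The sequence converges if $\mathrm{Li}(K_n)=\mathrm{Ls}(K_n)$, and $X\in\mathrm{GBW}$ means that every sequence of subsets of $X$ has a convergent subsequence. Let $W$ be the universe of sets, or $V_\alpha$ for some limit ordinal $\alpha$, or $H(\theta)$ (the set of all sets hereditarily of cardinality less than $\theta$) for some uncountable regular cardinal $\theta$. Let $M$ be an elementary submodel of $W$, that is $(M,\in)\prec(W,\in)$, with $(Z,\mathcal T)\in M$, and suppose that $M$ is countably closed, that is $M^\omega\subseteq M$: every function from $\omega$ to $M$ is an element of $M$. Theorem. If $(Z,\mathcal T)\notin\mathrm{GBW}$, then $Z_M\notin\mathrm{GBW}$, where $Z_M$ is the set $Z\cap M$ with the topology generated by the family $\{U\cap M : U\in\mathcal T\cap M\}$; moreover, this family is a base of that topology. -/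

import Mathlib

open Filter Topology

namespace Reflection

/-! ### Kuratowski convergence and the generalized Bolzano-Weierstrass property -/

section Kuratowski

variable {X : Type*} [TopologicalSpace X]

/-- The lower closed limit `Li K`: all points each of whose neighbourhoods meets `K n` for all but
finitely many `n`. -/
def lowerClosedLimit (K : ℕ → Set X) : Set X :=
  {x | ∀ U ∈ 𝓝 x, ∀ᶠ n in atTop, (U ∩ K n).Nonempty}

/-- The upper closed limit `Ls K`: all points each of whose neighbourhoods meets `K n` for
infinitely many `n`. -/
def upperClosedLimit (K : ℕ → Set X) : Set X :=
  {x | ∀ U ∈ 𝓝 x, ∃ᶠ n in atTop, (U ∩ K n).Nonempty}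

/-- A sequence of sets converges (in the sense of Kuratowski) if `Li K = Ls K`. -/
def KuratowskiConverges (K : ℕ → Set X) : Prop :=
  lowerClosedLimit K = upperClosedLimit K

end Kuratowski

/-- The generalized Bolzano-Weierstrass property: every sequence of subsets of `X` has a
convergent subsequence. -/
def GBW (X : Type*) (τ : TopologicalSpace X) : Prop :=
  ∀ K : ℕ → Set X, ∃ φ : ℕ → ℕ, StrictMono φ ∧ @KuratowskiConverges X τ (fun n => K (φ n))

/-! ### Topological spaces as sets in the universe `ZFSet` -/

/-- `T` is a topology on the set `Z`. -/
structure IsTopologyOn (Z T : ZFSet) : Prop where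
  subset : ∀ U ∈ T, U ⊆ Z
  whole : Z ∈ T
  inter : ∀ U ∈ T, ∀ V ∈ T, U ∩ V ∈ T
  sUnion : ∀ S, S ⊆ T → ZFSet.sUnion S ∈ T

/-- The topological space with points the elements of `Z` whose open sets are the members
of `T`. -/
@[reducible] def IsTopologyOn.space {Z T : ZFSet} (h : IsTopologyOn Z T) :
    TopologicalSpace {x : ZFSet // x ∈ Z} where
  IsOpen O := ∃ U ∈ T, O = {x | x.1 ∈ U}
  isOpen_univ := ⟨Z, h.whole, by ext x; simp⟩
  isOpen_inter := by
    rintro _ _ ⟨U, hU, rfl⟩ ⟨V, hV, rfl⟩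
    exact ⟨U ∩ V, h.inter U hU V hV, by ext x; simp⟩
  isOpen_sUnion := by
    intro s hs
    refine ⟨ZFSet.sUnion (ZFSet.sep (fun U => {x : {x : ZFSet // x ∈ Z} | x.1 ∈ U} ∈ s) T),
      h.sUnion _ ZFSet.sep_subset, ?_⟩
    ext x
    simp only [Set.mem_sUnion, Set.mem_ofPred_eq, ZFSet.mem_sUnion, ZFSet.mem_sep]
    constructor
    · rintro ⟨O, hO, hx⟩
      obtain ⟨U, hU, rfl⟩ := hs O hO
      exact ⟨U, ⟨hU, hO⟩, hx⟩
    · rintro ⟨U, ⟨-, hU⟩, hx⟩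
      exact ⟨_, hU, hx⟩

/-! ### Elementary submodels -/

/-- The relation symbols of the language of set theory: one binary symbol. -/
inductive SetRel : ℕ → Type
  | mem : SetRel 2

/-- The first-order language of set theory, with the single symbol `∈`. -/
def setLanguage : FirstOrder.Language := ⟨fun _ => Empty, SetRel⟩

/-- Each class of sets is a structure `(W, ∈)` for the language of set theory. -/
instance setStructure (W : Set ZFSet) : setLanguage.Structure W where
  funMap := fun f => nomatch f
  RelMap := fun {_} r => match r with
    | .mem => fun v => (v 0 : ZFSet) ∈ (v 1 : ZFSet)

/-- `M` is an elementary submodel of `W`, that is `(M, ∈) ≺ (W, ∈)`: the identity of `M` is an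
elementary embedding of `M` into `W`. -/
def IsElementarySubmodel (M W : Set ZFSet) : Prop :=
  ∃ f : FirstOrder.Language.ElementaryEmbedding setLanguage M W, ∀ x : M, (f x : ZFSet) = x

/-- `H(θ)`, the class of all sets which are hereditarily of cardinality less than `θ`. -/
def H (θ : Cardinal) : Set ZFSet :=
  {x | ZFSet.Hereditarily (fun y => ZFSet.card y < θ) x}

/-- The initial fragments of the universe: the universe itself, `V_α` for limit ordinals `α`, and
`H(θ)` for uncountable regular cardinals `θ`. -/
def IsInitialFragment (W : Set ZFSet) : Prop :=
  W = Set.univ ∨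
  (∃ α : Ordinal, Order.IsSuccLimit α ∧ W = {x | x ∈ ZFSet.vonNeumann α}) ∨
  (∃ θ : Cardinal, Cardinal.aleph0 < θ ∧ θ.IsRegular ∧ W = H θ)

/-- `M` is countably closed, `M ^ ω ⊆ M`: every function with domain `ω` and with values in `M`
is an element of `M`. -/
def CountablyClosed (M : Set ZFSet) : Prop :=
  ∀ y f : ZFSet, (∀ x ∈ y, x ∈ M) → ZFSet.IsFunc ZFSet.omega y f → f ∈ M

/-! ### The reflected space -/

/-- The underlying set `Z ∩ M` of the reflected space. -/
abbrev ReflectedSet (Z : ZFSet) (M : Set ZFSet) : Type _ := {x : ZFSet // x ∈ Z ∧ x ∈ M}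

/-- The family `{U ∩ M : U ∈ T ∩ M}` of subsets of `Z ∩ M`. -/
def reflectedBase (Z T : ZFSet) (M : Set ZFSet) : Set (Set (ReflectedSet Z M)) :=
  {O | ∃ U : ZFSet, U ∈ T ∧ U ∈ M ∧ O = {x | x.1 ∈ U}}

/-- The topology on `Z ∩ M` generated by the family `{U ∩ M : U ∈ T ∩ M}`. -/
@[reducible] def reflectedSpace (Z T : ZFSet) (M : Set ZFSet) : TopologicalSpace (ReflectedSet Z M) :=
  TopologicalSpace.generateFrom (reflectedBase Z T M)

end Reflection

/-!
Let `K` be a sequence of subsets of `Z` without a convergent subsequence. Failure of convergence of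
a subsequence at a point `x` says that every open set around `x` meets infinitely many terms and
some open set around `x` misses infinitely many terms (`not_kuratowskiConverges_iff`). Coding `K`
as a relation `R ⊆ ω × Z` and subsequences as cofinal subsets `A ⊆ ω`, this is expressed by
formulas of set theory all of whose relevant objects lie in `W`, because `W` is closed under
elements, subsets and products. So `W` knows such an `R`
(`exists_hasNoConvergentSubsequence`), and by elementarity there is one in `M`.

The sequence of the traces on `M` of the sections of this `R` has no convergent subsequence in
`Z_M`. Indeed, a subsequence is given by a set `A ⊆ ω` of natural numbers; these are all in `M`, and
since `M` is countably closed, `A ∈ M` (`IsElementarySubmodel.range_mem`). By elementarity some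
`x ∈ Z ∩ M` witnesses that the subsequence along `A` diverges. If `U ∈ T ∩ M` contains `x`, then `U`
meets infinitely many terms, and by elementarity it meets them in points of `M`; and an open set
around `x` that misses infinitely many terms can be chosen in `M`. As `T ∩ M` is closed under
intersections, its traces form a base of `Z_M`, so these sets decide convergence.

Elementarity is used only through the Tarski-Vaught criterion
(`IsElementarySubmodel.exists_mem`), applied to predicates shown to be definable by closing the
atomic ones under connectives and quantifiers over `W` (`IsDefinable`).
-/

namespace Reflection

open FirstOrder Language

/-! ### Definable predicates -/

variable {W M : Set ZFSet} {α : Type}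

/-- A predicate of families of elements of `W` is definable if it is given by a formula of the
language of set theory, interpreted in `(W, ∈)`. -/
def IsDefinable (P : (α → W) → Prop) : Prop :=
  ∃ φ : setLanguage.Formula α, ∀ v, φ.Realize v ↔ P v

namespace IsDefinable

theorem mem (i j : α) : IsDefinable fun v : α → W => (v i : ZFSet) ∈ (v j : ZFSet) :=
  ⟨Relations.formula₂ (L := setLanguage) (show setLanguage.Relations 2 from SetRel.mem)
    (Term.var i) (Term.var j), fun _ => Formula.realize_rel₂.trans Iff.rfl⟩

theorem eq (i j : α) : IsDefinable fun v : α → W => (v i : ZFSet) = (v j : ZFSet) :=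
  ⟨Term.equal (Term.var i) (Term.var j), fun v => by
    rw [Formula.realize_equal]; exact Subtype.ext_iff⟩

theorem not {P : (α → W) → Prop} (hP : IsDefinable P) : IsDefinable fun v => ¬ P v := by
  obtain ⟨φ, hφ⟩ := hP
  exact ⟨∼φ, fun v => by rw [Formula.realize_not, hφ]⟩

theorem and {P Q : (α → W) → Prop} (hP : IsDefinable P) (hQ : IsDefinable Q) :
    IsDefinable fun v => P v ∧ Q v := by
  obtain ⟨φ, hφ⟩ := hP
  obtain ⟨ψ, hψ⟩ := hQ
  exact ⟨φ ⊓ ψ, fun v => by rw [Formula.realize_inf, hφ, hψ]⟩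

theorem or {P Q : (α → W) → Prop} (hP : IsDefinable P) (hQ : IsDefinable Q) :
    IsDefinable fun v => P v ∨ Q v := by
  obtain ⟨φ, hφ⟩ := hP
  obtain ⟨ψ, hψ⟩ := hQ
  exact ⟨φ ⊔ ψ, fun v => by rw [Formula.realize_sup, hφ, hψ]⟩

theorem imp {P Q : (α → W) → Prop} (hP : IsDefinable P) (hQ : IsDefinable Q) :
    IsDefinable fun v => P v → Q v := by
  obtain ⟨φ, hφ⟩ := hP
  obtain ⟨ψ, hψ⟩ := hQ
  exact ⟨φ.imp ψ, fun v => by rw [Formula.realize_imp, hφ, hψ]⟩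

theorem iff {P Q : (α → W) → Prop} (hP : IsDefinable P) (hQ : IsDefinable Q) :
    IsDefinable fun v => P v ↔ Q v := by
  obtain ⟨φ, hφ⟩ := hP
  obtain ⟨ψ, hψ⟩ := hQ
  exact ⟨φ.iff ψ, fun v => by rw [Formula.realize_iff, hφ, hψ]⟩

/-- Quantification over `W`; the quantified variable is `none`. -/
theorem ex {P : (α → W) → W → Prop}
    (hP : IsDefinable fun w : Option α → W => P (fun a => w (some a)) (w none)) :
    IsDefinable fun v => ∃ y, P v y := by
  obtain ⟨φ, hφ⟩ := hP
  let g : Option α → α ⊕ Unit := fun o => o.elim (Sum.inr ()) Sum.inl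
  refine ⟨(φ.relabel g).iExs Unit, fun v => ?_⟩
  simp only [Formula.realize_iExs, Formula.realize_relabel, hφ]
  exact ⟨fun ⟨i, hi⟩ => ⟨i (), hi⟩, fun ⟨y, hy⟩ => ⟨fun _ => y, hy⟩⟩

theorem all {P : (α → W) → W → Prop}
    (hP : IsDefinable fun w : Option α → W => P (fun a => w (some a)) (w none)) :
    IsDefinable fun v => ∀ y, P v y := by
  have h : IsDefinable fun v => ¬ ∃ y, ¬ P v y := (ex (P := fun v y => ¬ P v y) hP.not).not
  simpa using h

end IsDefinable

/-! ### Elementarity -/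

theorem IsElementarySubmodel.subset (hM : IsElementarySubmodel M W) : M ⊆ W := by
  obtain ⟨f, hf⟩ := hM
  intro x hx
  have h := (f ⟨x, hx⟩).2
  rwa [hf] at h

/-- The Tarski-Vaught criterion: a definable condition with parameters in `M` that is satisfied in
`W` is satisfied by an element of `M`. -/
theorem IsElementarySubmodel.exists_mem (hM : IsElementarySubmodel M W) {P : (α → W) → W → Prop}
    (hP : IsDefinable fun w : Option α → W => P (fun a => w (some a)) (w none)) (v : α → W)
    (hv : ∀ a, (v a : ZFSet) ∈ M) (h : ∃ y, P v y) : ∃ y : W, (y : ZFSet) ∈ M ∧ P v y := by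
  obtain ⟨f, hf⟩ := hM
  obtain ⟨φ, hφ⟩ := hP
  let g : Option α → α ⊕ Unit := fun o => o.elim (Sum.inr ()) Sum.inl
  let u : α → M := fun a => ⟨v a, hv a⟩
  have hu : f ∘ u = v := funext fun a => Subtype.ext (hf (u a))
  have h1 : ((φ.relabel g).iExs Unit).Realize (f ∘ u) := by
    obtain ⟨y, hy⟩ := h
    rw [Formula.realize_iExs]
    refine ⟨fun _ => y, ?_⟩
    rw [Formula.realize_relabel, hφ, hu]
    exact hy
  rw [f.map_formula, Formula.realize_iExs] at h1
  obtain ⟨i, hi⟩ := h1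
  rw [Formula.realize_relabel, ← f.map_formula, hφ] at hi
  refine ⟨f (i ()), by rw [hf]; exact (i ()).2, ?_⟩
  rw [← hu]
  exact hi

/-! ### Closure properties of the initial fragments -/

theorem IsInitialFragment.mem_of_mem (hW : IsInitialFragment W) {x y : ZFSet} (hxy : x ∈ y)
    (hy : y ∈ W) : x ∈ W := by
  obtain rfl | ⟨a, -, rfl⟩ | ⟨θ, -, -, rfl⟩ := hW
  · trivial
  · exact (ZFSet.isTransitive_vonNeumann a).subset_of_mem hy hxy
  · exact ZFSet.Hereditarily.mem hy hxy

theorem IsInitialFragment.mem_of_subset (hW : IsInitialFragment W) {x y : ZFSet} (hxy : x ⊆ y)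
    (hy : y ∈ W) : x ∈ W := by
  obtain rfl | ⟨a, -, rfl⟩ | ⟨θ, -, -, rfl⟩ := hW
  · trivial
  · exact ZFSet.mem_vonNeumann_of_subset hxy hy
  · exact (ZFSet.hereditarily_iff).2
      ⟨(ZFSet.card_mono hxy).trans_lt hy.self, fun z hz => hy.mem (hxy hz)⟩

theorem H.unorderedPair_mem {θ : Cardinal} (hθ : Cardinal.aleph0 < θ) {x y : ZFSet} (hx : x ∈ H θ)
    (hy : y ∈ H θ) : ({x, y} : ZFSet) ∈ H θ := by
  refine (ZFSet.hereditarily_iff).2 ⟨?_, ?_⟩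
  · have h := ZFSet.card_insert_le (x := x) (y := {y})
    rw [ZFSet.card_singleton] at h
    refine h.trans_lt (lt_trans ?_ hθ)
    exact_mod_cast Cardinal.natCast_lt_aleph0 (n := 2)
  · intro z hz
    rcases ZFSet.mem_pair.1 hz with rfl | rfl
    exacts [hx, hy]

theorem card_prod (x y : ZFSet) : ZFSet.card (ZFSet.prod x y) = ZFSet.card x * ZFSet.card y := by
  rw [← Cardinal.lift_inj, Cardinal.lift_mul, ← ZFSet.cardinalMk_coe_sort,
    ← ZFSet.cardinalMk_coe_sort, ← ZFSet.cardinalMk_coe_sort, Cardinal.mul_def]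
  refine Cardinal.mk_congr (Equiv.ofBijective
    (fun p : x × y => ⟨ZFSet.pair p.1 p.2, ZFSet.pair_mem_prod.2 ⟨p.1.2, p.2.2⟩⟩) ⟨?_, ?_⟩).symm
  · rintro ⟨a, b⟩ ⟨c, d⟩ h
    obtain ⟨h1, h2⟩ := ZFSet.pair_injective (Subtype.ext_iff.1 h)
    exact Prod.ext (Subtype.ext h1) (Subtype.ext h2)
  · rintro ⟨p, hp⟩
    obtain ⟨a, ha, b, hb, rfl⟩ := ZFSet.mem_prod.1 hp
    exact ⟨⟨⟨a, ha⟩, ⟨b, hb⟩⟩, rfl⟩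

theorem IsInitialFragment.prod_mem (hW : IsInitialFragment W) {x y : ZFSet} (hx : x ∈ W)
    (hy : y ∈ W) : ZFSet.prod x y ∈ W := by
  obtain rfl | ⟨a, ha, rfl⟩ | ⟨θ, hθ, -, rfl⟩ := hW
  · trivial
  · have h : ZFSet.prod x y ⊆ ZFSet.powerset (ZFSet.powerset (x ∪ y)) := by
      intro p hp
      obtain ⟨a, ha, b, hb, rfl⟩ := ZFSet.mem_prod.1 hp
      simp only [ZFSet.pair, ZFSet.mem_powerset]
      intro q hq
      rw [ZFSet.mem_powerset]
      intro z hz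
      rw [ZFSet.mem_union]
      rcases ZFSet.mem_pair.1 hq with rfl | rfl
      · exact Or.inl (ZFSet.mem_singleton.1 hz ▸ ha)
      · rcases ZFSet.mem_pair.1 hz with rfl | rfl
        exacts [Or.inl ha, Or.inr hb]
    refine ZFSet.mem_vonNeumann_of_subset h (ZFSet.mem_vonNeumann.2 ?_)
    rw [ZFSet.rank_powerset, ZFSet.rank_powerset, ZFSet.rank_union]
    exact ha.succ_lt (ha.succ_lt (max_lt (ZFSet.mem_vonNeumann.1 hx) (ZFSet.mem_vonNeumann.1 hy)))
  · refine (ZFSet.hereditarily_iff).2 ⟨?_, ?_⟩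
    · rw [card_prod]
      exact Cardinal.mul_lt_of_lt hθ.le hx.self hy.self
    · intro p hp
      obtain ⟨a, ha, b, hb, rfl⟩ := ZFSet.mem_prod.1 hp
      exact H.unorderedPair_mem hθ (by simpa using H.unorderedPair_mem hθ (hx.mem ha) (hx.mem ha))
        (H.unorderedPair_mem hθ (hx.mem ha) (hy.mem hb))

/-! ### The natural numbers -/

/-- The von Neumann natural number `n`. -/
noncomputable def natSet (n : ℕ) : ZFSet := (n : Ordinal).toZFSet

theorem natSet_zero : natSet 0 = ∅ := by simp [natSet]

theorem natSet_succ (n : ℕ) : natSet (n + 1) = insert (natSet n) (natSet n) := by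
  simp [natSet, Ordinal.toZFSet_add_one]

theorem natSet_mem_natSet {m n : ℕ} : natSet m ∈ natSet n ↔ m < n := by
  simp [natSet, Ordinal.toZFSet_mem_toZFSet_iff]

theorem natSet_injective : Function.Injective natSet := fun m n h => by
  simpa [natSet] using Ordinal.toZFSet_injective h

theorem mk_ofNat (n : ℕ) : ZFSet.mk (PSet.ofNat n) = natSet n := by
  induction n with
  | zero => rw [natSet_zero]; rfl
  | succ n ih => rw [natSet_succ, ← ih]; rfl

theorem mem_omega {x : ZFSet} : x ∈ ZFSet.omega ↔ ∃ n, x = natSet n := by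
  constructor
  · refine Quotient.inductionOn x fun x hx => ?_
    obtain ⟨n, hn⟩ := hx
    exact ⟨n.down, (mk_ofNat n.down) ▸ Quotient.sound hn⟩
  · rintro ⟨n, rfl⟩
    rw [← mk_ofNat]
    exact ⟨⟨n⟩, PSet.Equiv.refl _⟩

theorem natSet_mem_omega (n : ℕ) : natSet n ∈ ZFSet.omega := mem_omega.2 ⟨n, rfl⟩

theorem card_omega_le : ZFSet.card ZFSet.omega ≤ Cardinal.aleph0 := by
  rw [← Cardinal.lift_le, ← ZFSet.cardinalMk_coe_sort, Cardinal.lift_aleph0]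
  have : Function.Surjective
      (fun n : ℕ => (⟨natSet n, natSet_mem_omega n⟩ : (ZFSet.omega : ZFSet))) := by
    rintro ⟨x, hx⟩
    obtain ⟨n, rfl⟩ := mem_omega.1 hx
    exact ⟨n, rfl⟩
  have := this.countable
  exact Cardinal.mk_le_aleph0

/-- Countable closure for sequences of elements of `M`. -/
theorem CountablyClosed.exists_graph_mem (hc : CountablyClosed M) (g : ℕ → ZFSet)
    (hg : ∀ n, g n ∈ M) :
    ∃ f ∈ M, ∀ p, p ∈ f ↔ ∃ n, p = ZFSet.pair (natSet n) (g n) := by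
  let y : ZFSet := ZFSet.range fun n : ℕ => g n
  let f : ZFSet := ZFSet.range fun n : ℕ => ZFSet.pair (natSet n) (g n)
  have hf : ∀ p, p ∈ f ↔ ∃ n, p = ZFSet.pair (natSet n) (g n) := fun p => by
    simp [f, eq_comm]
  refine ⟨f, hc y f ?_ ⟨?_, ?_⟩, hf⟩
  · intro x hx
    obtain ⟨n, rfl⟩ := ZFSet.mem_range.1 hx
    exact hg n
  · intro p hp
    obtain ⟨n, rfl⟩ := (hf p).1 hp
    exact ZFSet.pair_mem_prod.2 ⟨natSet_mem_omega n, ZFSet.mem_range.2 ⟨n, rfl⟩⟩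
  · intro z hz
    obtain ⟨n, rfl⟩ := mem_omega.1 hz
    refine ⟨g n, (hf _).2 ⟨n, rfl⟩, fun w hw => ?_⟩
    obtain ⟨k, hk⟩ := (hf _).1 hw
    obtain ⟨h1, h2⟩ := ZFSet.pair_injective hk
    rw [h2, natSet_injective h1]

/-- The set `M` is needed to exclude `W = V_ω`: a constant function on `ω` with value in `M` belongs
to `M`, hence to `W`, and its rank exceeds that of `ω`. -/
theorem IsInitialFragment.omega_mem (hW : IsInitialFragment W) (hMW : M ⊆ W)
    (hc : CountablyClosed M) (hne : M.Nonempty) : ZFSet.omega ∈ W := by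
  obtain ⟨m, hm⟩ := hne
  obtain ⟨f, hfM, hf⟩ := hc.exists_graph_mem (fun _ => m) fun _ => hm
  have hfW := hMW hfM
  have hn (n : ℕ) : ∃ y, natSet n ∈ y ∧ ∃ z, y ∈ z ∧ z ∈ f :=
    ⟨{natSet n}, by simp, ZFSet.pair (natSet n) m, by simp [ZFSet.pair], (hf _).2 ⟨n, rfl⟩⟩
  obtain rfl | ⟨a, ha, rfl⟩ | ⟨θ, hθ, -, rfl⟩ := id hW
  · trivial
  · refine ZFSet.mem_vonNeumann.2 (lt_of_le_of_lt ?_ (ZFSet.mem_vonNeumann.1 hfW))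
    rw [ZFSet.rank_le_iff]
    intro x hx
    obtain ⟨n, rfl⟩ := mem_omega.1 hx
    obtain ⟨y, h1, z, h2, h3⟩ := hn n
    exact (ZFSet.rank_lt_of_mem h1).trans
      ((ZFSet.rank_lt_of_mem h2).trans (ZFSet.rank_lt_of_mem h3))
  · refine (ZFSet.hereditarily_iff).2 ⟨card_omega_le.trans_lt hθ, fun x hx => ?_⟩
    obtain ⟨n, rfl⟩ := mem_omega.1 hx
    obtain ⟨y, h1, z, h2, h3⟩ := hn n
    exact hW.mem_of_mem h1 (hW.mem_of_mem h2 (hW.mem_of_mem h3 hfW))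

/-! ### Ordered pairs and the elements of the submodel -/

/-- Extensionality in `W`, which holds because `W` is transitive. -/
theorem IsInitialFragment.ext (hW : IsInitialFragment W) {x y : ZFSet} (hx : x ∈ W) (hy : y ∈ W)
    (h : ∀ z : W, (z : ZFSet) ∈ x ↔ (z : ZFSet) ∈ y) : x = y :=
  ZFSet.ext fun z => ⟨fun hz => (h ⟨z, hW.mem_of_mem hz hx⟩).1 hz,
    fun hz => (h ⟨z, hW.mem_of_mem hz hy⟩).2 hz⟩

theorem IsDefinable.eq_unorderedPair (hW : IsInitialFragment W) (p i j : α) :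
    IsDefinable fun v : α → W => (v p : ZFSet) = {(v i : ZFSet), (v j : ZFSet)} := by
  have h : IsDefinable fun v : α → W => (v i : ZFSet) ∈ (v p : ZFSet) ∧
      (v j : ZFSet) ∈ (v p : ZFSet) ∧
      ∀ z : W, (z : ZFSet) ∈ (v p : ZFSet) → (z : ZFSet) = v i ∨ (z : ZFSet) = v j :=
    (mem _ _).and ((mem _ _).and (.all (.imp (mem _ _) (.or (eq _ _) (eq _ _)))))
  convert h using 2 with v
  constructor
  · intro hp
    simp [hp]
  · rintro ⟨hi, hj, hz⟩
    ext z
    rw [ZFSet.mem_pair]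
    refine ⟨fun h => hz ⟨z, hW.mem_of_mem h (v p).2⟩ h, ?_⟩
    rintro (rfl | rfl) <;> assumption

theorem IsDefinable.eq_pair (hW : IsInitialFragment W) (p i j : α) :
    IsDefinable fun v : α → W => (v p : ZFSet) = ZFSet.pair (v i : ZFSet) (v j : ZFSet) := by
  have h : IsDefinable fun v : α → W => ∃ a b : W, (a : ZFSet) = {(v i : ZFSet), (v i : ZFSet)} ∧
      (b : ZFSet) = {(v i : ZFSet), (v j : ZFSet)} ∧ (v p : ZFSet) = {(a : ZFSet), (b : ZFSet)} :=
    .ex (.ex ((eq_unorderedPair hW _ _ _).and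
      ((eq_unorderedPair hW _ _ _).and (eq_unorderedPair hW _ _ _))))
  convert h using 2 with v
  constructor
  · intro hp
    have h1 : ({(v i : ZFSet)} : ZFSet) ∈ (v p : ZFSet) := by simp [hp, ZFSet.pair]
    have h2 : ({(v i : ZFSet), (v j : ZFSet)} : ZFSet) ∈ (v p : ZFSet) := by simp [hp, ZFSet.pair]
    exact ⟨⟨_, hW.mem_of_mem h1 (v p).2⟩, ⟨_, hW.mem_of_mem h2 (v p).2⟩, by simp, rfl, hp⟩
  · rintro ⟨a, b, ha, hb, hp⟩
    rw [hp, ha, hb, ZFSet.pair, ZFSet.pair_eq_singleton]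

/-- The components of an ordered pair in `M` are in `M`. -/
theorem IsElementarySubmodel.of_pair_mem (hW : IsInitialFragment W)
    (hM : IsElementarySubmodel M W) {x y : ZFSet} (h : ZFSet.pair x y ∈ M) : x ∈ M ∧ y ∈ M := by
  have hp := hM.subset h
  have h1 : ({x, y} : ZFSet) ∈ W :=
    hW.mem_of_mem (y := ZFSet.pair x y) (by simp [ZFSet.pair]) hp
  have hx : x ∈ W := hW.mem_of_mem (by simp) h1
  have hy : y ∈ W := hW.mem_of_mem (by simp) h1
  constructor
  · obtain ⟨a, haM, b, hab⟩ := hM.exists_mem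
      (P := fun v a => ∃ b : W, (v () : ZFSet) = ZFSet.pair (a : ZFSet) (b : ZFSet))
      (.ex (.eq_pair hW _ _ _)) (fun _ => ⟨_, hp⟩) (fun _ => h) ⟨⟨x, hx⟩, ⟨y, hy⟩, rfl⟩
    rwa [(ZFSet.pair_injective hab).1]
  · obtain ⟨b, hbM, a, hab⟩ := hM.exists_mem
      (P := fun v b => ∃ a : W, (v () : ZFSet) = ZFSet.pair (a : ZFSet) (b : ZFSet))
      (.ex (.eq_pair hW _ _ _)) (fun _ => ⟨_, hp⟩) (fun _ => h) ⟨⟨y, hy⟩, ⟨x, hx⟩, rfl⟩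
    rwa [(ZFSet.pair_injective hab).2]

theorem IsElementarySubmodel.inter_mem (hW : IsInitialFragment W)
    (hM : IsElementarySubmodel M W) {x y : ZFSet} (hx : x ∈ M) (hy : y ∈ M) : x ∩ y ∈ M := by
  have hxy : x ∩ y ∈ W :=
    hW.mem_of_subset (fun z hz => (ZFSet.mem_inter.1 hz).1) (hM.subset hx)
  obtain ⟨a, haM, ha⟩ := hM.exists_mem (α := Fin 2)
    (P := fun v a => ∀ z : W, (z : ZFSet) ∈ (a : ZFSet) ↔
      (z : ZFSet) ∈ (v 0 : ZFSet) ∧ (z : ZFSet) ∈ (v 1 : ZFSet))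
    (.all (.iff (.mem _ _) (.and (.mem _ _) (.mem _ _))))
    ![⟨x, hM.subset hx⟩, ⟨y, hM.subset hy⟩] (Fin.forall_fin_two.2 ⟨hx, hy⟩)
    ⟨⟨x ∩ y, hxy⟩, fun z => ZFSet.mem_inter⟩
  rwa [hW.ext hxy a.2 fun z => ZFSet.mem_inter.trans (ha z).symm]

theorem IsElementarySubmodel.empty_mem (hW : IsInitialFragment W)
    (hM : IsElementarySubmodel M W) (hne : M.Nonempty) : ∅ ∈ M := by
  obtain ⟨m, hm⟩ := hne
  have h0 : ∅ ∈ W := hW.mem_of_subset (ZFSet.empty_subset m) (hM.subset hm)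
  obtain ⟨a, haM, ha⟩ := hM.exists_mem (α := Empty)
    (P := fun _ a => ∀ z : W, ¬ (z : ZFSet) ∈ (a : ZFSet))
    (.all (.not (.mem _ _))) (fun x => x.elim) (fun x => x.elim)
    ⟨⟨∅, h0⟩, fun z => ZFSet.notMem_empty _⟩
  rwa [hW.ext h0 a.2 fun z => iff_of_false (ZFSet.notMem_empty _) (ha z)]

theorem IsElementarySubmodel.insert_self_mem (hW : IsInitialFragment W)
    (hM : IsElementarySubmodel M W) {x : ZFSet} (hx : x ∈ M) (hs : insert x x ∈ W) :
    insert x x ∈ M := by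
  obtain ⟨a, haM, ha⟩ := hM.exists_mem
    (P := fun v a => ∀ z : W, (z : ZFSet) ∈ (a : ZFSet) ↔
      (z : ZFSet) = (v () : ZFSet) ∨ (z : ZFSet) ∈ (v () : ZFSet))
    (.all (.iff (.mem _ _) (.or (.eq _ _) (.mem _ _))))
    (fun _ => ⟨x, hM.subset hx⟩) (fun _ => hx)
    ⟨⟨insert x x, hs⟩, fun z => ZFSet.mem_insert_iff⟩
  rwa [hW.ext hs a.2 fun z => ZFSet.mem_insert_iff.trans (ha z).symm]

theorem IsElementarySubmodel.natSet_mem (hW : IsInitialFragment W)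
    (hM : IsElementarySubmodel M W) (hc : CountablyClosed M) (hne : M.Nonempty) (n : ℕ) :
    natSet n ∈ M := by
  have hω := hW.omega_mem hM.subset hc hne
  induction n with
  | zero => rw [natSet_zero]; exact hM.empty_mem hW hne
  | succ n ih =>
    have h := hW.mem_of_mem (natSet_mem_omega (n + 1)) hω
    rw [natSet_succ] at h ⊢
    exact hM.insert_self_mem hW ih h

/-- The range of a sequence of elements of `M` is in `M`, being definable from the sequence. -/
theorem IsElementarySubmodel.range_mem (hW : IsInitialFragment W)
    (hM : IsElementarySubmodel M W) (hc : CountablyClosed M) {g : ℕ → ZFSet} (hg : ∀ n, g n ∈ M)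
    {S : ZFSet} (hS : S ∈ W) (hSg : ∀ x, x ∈ S ↔ ∃ n, x = g n) : S ∈ M := by
  have hω := hW.omega_mem hM.subset hc ⟨_, hg 0⟩
  obtain ⟨f, hfM, hf⟩ := hc.exists_graph_mem g hg
  have hS' (z : W) : (z : ZFSet) ∈ S ↔
      ∃ n p : W, (p : ZFSet) ∈ f ∧ (p : ZFSet) = ZFSet.pair (n : ZFSet) (z : ZFSet) := by
    rw [hSg]
    constructor
    · rintro ⟨n, hn⟩
      have hp := (hf _).2 ⟨n, rfl⟩
      exact ⟨⟨_, hW.mem_of_mem (natSet_mem_omega n) hω⟩,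
        ⟨_, hW.mem_of_mem hp (hM.subset hfM)⟩, hp, by rw [hn]⟩
    · rintro ⟨n, p, hp, hpn⟩
      obtain ⟨k, hk⟩ := (hf _).1 hp
      exact ⟨k, (ZFSet.pair_injective (hpn.symm.trans hk)).2⟩
  obtain ⟨a, haM, ha⟩ := hM.exists_mem
    (P := fun v a => ∀ z : W, (z : ZFSet) ∈ (a : ZFSet) ↔ ∃ n p : W,
      (p : ZFSet) ∈ (v () : ZFSet) ∧ (p : ZFSet) = ZFSet.pair (n : ZFSet) (z : ZFSet))
    (.all (.iff (.mem _ _) (.ex (.ex (.and (.mem _ _) (.eq_pair hW _ _ _))))))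
    (fun _ => ⟨f, hM.subset hfM⟩) (fun _ => hfM) ⟨⟨S, hS⟩, hS'⟩
  rwa [hW.ext hS a.2 fun z => (hS' z).trans (ha z).symm]

/-! ### Sequences of sets without convergent subsequences -/

/-- With respect to a topological base, a sequence of sets fails to converge if and only if there
are a point `x` all of whose basic neighbourhoods meet infinitely many of the sets, and a basic
neighbourhood of `x` that is disjoint from infinitely many of them. -/
theorem not_kuratowskiConverges_iff {X : Type*} [TopologicalSpace X] {B : Set (Set X)}
    (hB : TopologicalSpace.IsTopologicalBasis B) (K : ℕ → Set X) :
    ¬ KuratowskiConverges K ↔ ∃ x, (∀ U ∈ B, x ∈ U → ∃ᶠ n in atTop, (U ∩ K n).Nonempty) ∧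
      ∃ U ∈ B, x ∈ U ∧ ∃ᶠ n in atTop, ¬ (U ∩ K n).Nonempty := by
  have hle : lowerClosedLimit K ⊆ upperClosedLimit K := fun x hx U hU => (hx U hU).frequently
  rw [KuratowskiConverges, Set.Subset.antisymm_iff, and_iff_right hle, Set.not_subset]
  refine exists_congr fun x => and_congr ?_ ?_
  · constructor
    · exact fun hx U hU hxU => hx U (hB.mem_nhds hU hxU)
    · intro hx V hV
      obtain ⟨U, hU, hxU, hUV⟩ := hB.mem_nhds_iff.1 hV
      exact (hx U hU hxU).mono fun n hn => hn.mono (Set.inter_subset_inter_left _ hUV)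
  · simp only [lowerClosedLimit, Set.mem_ofPred_eq, not_forall, not_eventually]
    constructor
    · rintro ⟨V, hV, hn⟩
      obtain ⟨U, hU, hxU, hUV⟩ := hB.mem_nhds_iff.1 hV
      exact ⟨U, hU, hxU, hn.mono fun n h h' => h (h'.mono (Set.inter_subset_inter_left _ hUV))⟩
    · rintro ⟨U, hU, hxU, hn⟩
      exact ⟨U, hB.mem_nhds hU hxU, hn⟩

/-- The section of the relation `R` at `n` meets the set `U`, in terms of elements of `W`. -/
def SectionMeets (R n U : W) : Prop :=
  ∃ y : W, (y : ZFSet) ∈ (U : ZFSet) ∧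
    ∃ p : W, (p : ZFSet) ∈ (R : ZFSet) ∧ (p : ZFSet) = ZFSet.pair (n : ZFSet) (y : ZFSet)

/-- The sections of `R` at cofinally many elements of `A ⊆ ω` meet `U`. -/
def CofinallyMeets (ω R A U : W) : Prop :=
  ∀ m : W, (m : ZFSet) ∈ (ω : ZFSet) → ∃ n : W, (n : ZFSet) ∈ (A : ZFSet) ∧
    ¬ (n : ZFSet) ∈ (m : ZFSet) ∧ SectionMeets R n U

/-- The sections of `R` at cofinally many elements of `A ⊆ ω` are disjoint from `U`. -/
def CofinallyMisses (ω R A U : W) : Prop :=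
  ∀ m : W, (m : ZFSet) ∈ (ω : ZFSet) → ∃ n : W, (n : ZFSet) ∈ (A : ZFSet) ∧
    ¬ (n : ZFSet) ∈ (m : ZFSet) ∧ ¬ SectionMeets R n U

/-- The point `x` witnesses that the sequence of the sections of `R` at the elements of `A ⊆ ω`
does not converge. -/
def IsDivergencePoint (ω Z T R A x : W) : Prop :=
  (x : ZFSet) ∈ (Z : ZFSet) ∧
  (∀ U : W, (U : ZFSet) ∈ (T : ZFSet) → (x : ZFSet) ∈ (U : ZFSet) → CofinallyMeets ω R A U) ∧
  ∃ U : W, (U : ZFSet) ∈ (T : ZFSet) ∧ (x : ZFSet) ∈ (U : ZFSet) ∧ CofinallyMisses ω R A U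

/-- The sequence of the sections of `R` at the elements of `ω` has no convergent subsequence;
the subsequences are given by the cofinal subsets `A` of `ω`. -/
def HasNoConvergentSubsequence (ω Z T R : W) : Prop :=
  ∀ A : W, (∀ n : W, (n : ZFSet) ∈ (A : ZFSet) → (n : ZFSet) ∈ (ω : ZFSet)) →
    (∀ m : W, (m : ZFSet) ∈ (ω : ZFSet) → ∃ n : W, (n : ZFSet) ∈ (A : ZFSet) ∧
      ¬ (n : ZFSet) ∈ (m : ZFSet)) →
    ∃ x : W, IsDivergencePoint ω Z T R A x

theorem IsDefinable.sectionMeets (hW : IsInitialFragment W) (R n U : α) :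
    IsDefinable fun v : α → W => SectionMeets (v R) (v n) (v U) :=
  .ex (.and (.mem _ _) (.ex (.and (.mem _ _) (.eq_pair hW _ _ _))))

theorem IsDefinable.cofinallyMeets (hW : IsInitialFragment W) (ω R A U : α) :
    IsDefinable fun v : α → W => CofinallyMeets (v ω) (v R) (v A) (v U) :=
  .all (.imp (.mem _ _) (.ex
    (.and (.mem _ _) (.and (.not (.mem _ _)) (.sectionMeets hW _ _ _)))))

theorem IsDefinable.cofinallyMisses (hW : IsInitialFragment W) (ω R A U : α) :
    IsDefinable fun v : α → W => CofinallyMisses (v ω) (v R) (v A) (v U) :=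
  .all (.imp (.mem _ _) (.ex
    (.and (.mem _ _) (.and (.not (.mem _ _)) (.not (.sectionMeets hW _ _ _))))))

theorem IsDefinable.isDivergencePoint (hW : IsInitialFragment W) (ω Z T R A x : α) :
    IsDefinable fun v : α → W => IsDivergencePoint (v ω) (v Z) (v T) (v R) (v A) (v x) :=
  .and (.mem _ _) (.and
    (.all (.imp (.mem _ _) (.imp (.mem _ _) (.cofinallyMeets hW _ _ _ _))))
    (.ex (.and (.mem _ _) (.and (.mem _ _) (.cofinallyMisses hW _ _ _ _)))))

theorem IsDefinable.hasNoConvergentSubsequence (hW : IsInitialFragment W) (ω Z T R : α) :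
    IsDefinable fun v : α → W => HasNoConvergentSubsequence (v ω) (v Z) (v T) (v R) :=
  .all (.imp (.all (.imp (.mem _ _) (.mem _ _))) (.imp
    (.all (.imp (.mem _ _) (.ex (.and (.mem _ _) (.not (.mem _ _))))))
    (.ex (.isDivergencePoint hW _ _ _ _ _ _))))

theorem sectionMeets_iff (hW : IsInitialFragment W) {R n U : W} :
    SectionMeets R n U ↔ ∃ y ∈ (U : ZFSet), ZFSet.pair (n : ZFSet) y ∈ (R : ZFSet) := by
  constructor
  · rintro ⟨y, hy, p, hp, h⟩
    exact ⟨y, hy, h ▸ hp⟩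
  · rintro ⟨y, hy, hp⟩
    exact ⟨⟨y, hW.mem_of_mem hy U.2⟩, hy, ⟨_, hW.mem_of_mem hp R.2⟩, hp, rfl⟩

/-- Being cofinally often true on the range of a strictly increasing sequence of natural numbers,
expressed in `W`, means being true infinitely often along the sequence. -/
theorem cofinal_iff_frequently (hW : IsInitialFragment W) {ω A : W}
    (hω : (ω : ZFSet) = ZFSet.omega) {φ : ℕ → ℕ} (hφ : StrictMono φ)
    (hA : ∀ x, x ∈ (A : ZFSet) ↔ ∃ k, x = natSet (φ k)) (Q : ZFSet → Prop) :
    (∀ m : W, (m : ZFSet) ∈ (ω : ZFSet) → ∃ n : W, (n : ZFSet) ∈ (A : ZFSet) ∧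
      ¬ (n : ZFSet) ∈ (m : ZFSet) ∧ Q n) ↔ ∃ᶠ k in atTop, Q (natSet (φ k)) := by
  rw [frequently_atTop]
  constructor
  · intro h k
    have hk : natSet (φ k) ∈ (ω : ZFSet) := hω ▸ natSet_mem_omega _
    obtain ⟨n, hnA, hn, hQ⟩ := h ⟨_, hW.mem_of_mem hk ω.2⟩ hk
    obtain ⟨j, hj⟩ := (hA _).1 hnA
    rw [hj] at hn hQ
    rw [natSet_mem_natSet, hφ.lt_iff_lt, not_lt] at hn
    exact ⟨j, hn, hQ⟩
  · intro h m hm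
    obtain ⟨i, hi⟩ := mem_omega.1 (hω ▸ hm)
    obtain ⟨k, hk, hQ⟩ := h i
    have hkA := (hA _).2 ⟨k, rfl⟩
    refine ⟨⟨_, hW.mem_of_mem hkA A.2⟩, hkA, ?_, hQ⟩
    rw [hi, natSet_mem_natSet, not_lt]
    exact hk.trans (hφ.id_le k)

theorem cofinallyMeets_iff (hW : IsInitialFragment W) {ω R A U : W}
    (hω : (ω : ZFSet) = ZFSet.omega) {φ : ℕ → ℕ} (hφ : StrictMono φ)
    (hA : ∀ x, x ∈ (A : ZFSet) ↔ ∃ k, x = natSet (φ k)) :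
    CofinallyMeets ω R A U ↔
      ∃ᶠ k in atTop, ∃ y ∈ (U : ZFSet), ZFSet.pair (natSet (φ k)) y ∈ (R : ZFSet) := by
  simp only [CofinallyMeets, sectionMeets_iff hW]
  exact cofinal_iff_frequently hW hω hφ hA fun n => ∃ y ∈ (U : ZFSet), ZFSet.pair n y ∈ (R : ZFSet)

theorem cofinallyMisses_iff (hW : IsInitialFragment W) {ω R A U : W}
    (hω : (ω : ZFSet) = ZFSet.omega) {φ : ℕ → ℕ} (hφ : StrictMono φ)
    (hA : ∀ x, x ∈ (A : ZFSet) ↔ ∃ k, x = natSet (φ k)) :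
    CofinallyMisses ω R A U ↔
      ∃ᶠ k in atTop, ¬ ∃ y ∈ (U : ZFSet), ZFSet.pair (natSet (φ k)) y ∈ (R : ZFSet) := by
  simp only [CofinallyMisses, sectionMeets_iff hW]
  exact cofinal_iff_frequently hW hω hφ hA
    fun n => ¬ ∃ y ∈ (U : ZFSet), ZFSet.pair n y ∈ (R : ZFSet)

/-- The failure of `GBW` for `(Z, T)`, with the convergence of subsequences spelled out in terms of
members of `T`. -/
theorem IsTopologyOn.not_gbw_iff {Z T : ZFSet} (hT : IsTopologyOn Z T) :
    ¬ GBW {x : ZFSet // x ∈ Z} hT.space ↔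
      ∃ K : ℕ → Set {x : ZFSet // x ∈ Z}, ∀ φ : ℕ → ℕ, StrictMono φ → ∃ x : {x : ZFSet // x ∈ Z},
        (∀ U ∈ T, x.1 ∈ U → ∃ᶠ k in atTop, ∃ y ∈ K (φ k), y.1 ∈ U) ∧
        ∃ U ∈ T, x.1 ∈ U ∧ ∃ᶠ k in atTop, ¬ ∃ y ∈ K (φ k), y.1 ∈ U := by
  let _ := hT.space
  simp only [GBW, not_forall, not_exists, not_and]
  refine exists_congr fun K => forall_congr' fun φ => imp_congr_right fun _ => ?_
  rw [not_kuratowskiConverges_iff TopologicalSpace.isTopologicalBasis_opens]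
  refine exists_congr fun x => and_congr ?_ ?_
  · constructor
    · intro h U hU hx
      exact (h {x | x.1 ∈ U} ⟨U, hU, rfl⟩ hx).mono fun n ⟨y, hyU, hy⟩ => ⟨y, hy, hyU⟩
    · rintro h _ ⟨U, hU, rfl⟩ hx
      exact (h U hU hx).mono fun n ⟨y, hy, hyU⟩ => ⟨y, hyU, hy⟩
  · constructor
    · rintro ⟨_, ⟨U, hU, rfl⟩, hx, h⟩
      exact ⟨U, hU, hx, h.mono fun n hn y hy hyU => hn ⟨y, hyU, hy⟩⟩
    · rintro ⟨U, hU, hx, h⟩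
      exact ⟨{x | x.1 ∈ U}, ⟨U, hU, rfl⟩, hx,
        h.mono fun n hn ⟨y, hyU, hy⟩ => hn y hy hyU⟩

/-- If the space `(Z, T)` is not in `GBW`, then `W` contains a sequence of subsets of `Z`, coded as
a subset of `ω × Z`, that has no convergent subsequence in the sense of `W`. -/
theorem exists_hasNoConvergentSubsequence (hW : IsInitialFragment W) {ω Z T : W}
    (hω : (ω : ZFSet) = ZFSet.omega) (hT : IsTopologyOn (Z : ZFSet) (T : ZFSet))
    (hZ : ¬ GBW {x : ZFSet // x ∈ (Z : ZFSet)} hT.space) :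
    ∃ R : W, HasNoConvergentSubsequence ω Z T R := by
  obtain ⟨K, hK⟩ := hT.not_gbw_iff.1 hZ
  let R : ZFSet := ZFSet.sep (fun p => ∃ n, ∃ z ∈ K n, p = ZFSet.pair (natSet n) z.1)
    (ZFSet.prod ω Z)
  have hR (n : ℕ) (y : ZFSet) : ZFSet.pair (natSet n) y ∈ R ↔ ∃ z ∈ K n, z.1 = y := by
    rw [ZFSet.mem_sep]
    constructor
    · rintro ⟨-, k, z, hz, h⟩
      obtain ⟨h1, h2⟩ := ZFSet.pair_injective h
      rw [natSet_injective h1]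
      exact ⟨z, hz, h2.symm⟩
    · rintro ⟨z, hz, rfl⟩
      exact ⟨ZFSet.pair_mem_prod.2 ⟨hω ▸ natSet_mem_omega n, z.2⟩, n, z, hz, rfl⟩
  have hRU (n : ℕ) (U : ZFSet) :
      (∃ y ∈ U, ZFSet.pair (natSet n) y ∈ R) ↔ ∃ z ∈ K n, z.1 ∈ U := by
    simp only [hR]
    constructor
    · rintro ⟨_, hy, z, hz, rfl⟩
      exact ⟨z, hz, hy⟩
    · rintro ⟨z, hz, hy⟩
      exact ⟨_, hy, z, hz, rfl⟩
  refine ⟨⟨R, hW.mem_of_subset (fun _ h => (ZFSet.mem_sep.1 h).1) (hW.prod_mem ω.2 Z.2)⟩, ?_⟩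
  intro A hAω hAcof
  -- The subsequence coded by `A` is the increasing enumeration of the infinite set `I`.
  let I : Set ℕ := {n | natSet n ∈ (A : ZFSet)}
  have hI : I.Infinite := by
    refine Set.infinite_of_not_bddAbove ?_
    rintro ⟨b, hb⟩
    have hb' : natSet (b + 1) ∈ (ω : ZFSet) := hω ▸ natSet_mem_omega _
    obtain ⟨n, hnA, hn⟩ := hAcof ⟨_, hW.mem_of_mem hb' ω.2⟩ hb'
    obtain ⟨k, hk⟩ := mem_omega.1 (hω ▸ hAω n hnA)
    rw [hk, natSet_mem_natSet] at hn
    have : k ≤ b := hb (show natSet k ∈ (A : ZFSet) from hk ▸ hnA)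
    omega
  let φ : ℕ → ℕ := Nat.nth (· ∈ I)
  have hφ : StrictMono φ := Nat.nth_strictMono hI
  have hA (x : ZFSet) : x ∈ (A : ZFSet) ↔ ∃ k, x = natSet (φ k) := by
    constructor
    · intro hx
      obtain ⟨n, rfl⟩ := mem_omega.1 (hω ▸ hAω ⟨x, hW.mem_of_mem hx A.2⟩ hx)
      have : n ∈ Set.range φ := by
        rw [show Set.range φ = I from Nat.range_nth_of_infinite hI]
        exact hx
      obtain ⟨k, rfl⟩ := this
      exact ⟨k, rfl⟩
    · rintro ⟨k, rfl⟩
      exact Nat.nth_mem_of_infinite hI k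
  obtain ⟨x, hx, U, hU, hxU, hmiss⟩ := hK φ hφ
  refine ⟨⟨x.1, hW.mem_of_mem x.2 Z.2⟩, x.2, fun V hV hxV => ?_, ⟨U, hW.mem_of_mem hU T.2⟩, hU,
    hxU, ?_⟩
  · rw [cofinallyMeets_iff hW hω hφ hA]
    simpa only [hRU] using hx V hV hxV
  · rw [cofinallyMisses_iff hW hω hφ hA]
    simpa only [hRU] using hmiss

/-! ### The reflected space -/

theorem isTopologicalBasis_reflectedBase {Z T : ZFSet} (hT : IsTopologyOn Z T)
    (hW : IsInitialFragment W) (hM : IsElementarySubmodel M W) (hZ : Z ∈ M) :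
    @TopologicalSpace.IsTopologicalBasis _ (reflectedSpace Z T M) (reflectedBase Z T M) := by
  let _ := reflectedSpace Z T M
  refine ⟨?_, ?_, rfl⟩
  · rintro _ ⟨U, hU, hUM, rfl⟩ _ ⟨V, hV, hVM, rfl⟩ x ⟨hxU, hxV⟩
    refine ⟨{x | x.1 ∈ U ∩ V}, ⟨U ∩ V, hT.inter U hU V hV, hM.inter_mem hW hUM hVM, rfl⟩,
      ZFSet.mem_inter.2 ⟨hxU, hxV⟩, fun y hy => ZFSet.mem_inter.1 hy⟩
  · exact Set.eq_univ_of_forall fun x => ⟨_, ⟨Z, hT.whole, hZ, rfl⟩, x.2.1⟩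

end Reflection

theorem mainTheorem9 (Z T : ZFSet) (hT : Reflection.IsTopologyOn Z T)
    (hZ : ¬ Reflection.GBW {x : ZFSet // x ∈ Z} hT.space)
    (W M : Set ZFSet) (hW : Reflection.IsInitialFragment W)
    (hM : Reflection.IsElementarySubmodel M W) (hZM : ZFSet.pair Z T ∈ M)
    (hc : Reflection.CountablyClosed M) :
    @TopologicalSpace.IsTopologicalBasis _ (Reflection.reflectedSpace Z T M)
        (Reflection.reflectedBase Z T M) ∧
      ¬ Reflection.GBW (Reflection.ReflectedSet Z M) (Reflection.reflectedSpace Z T M) := by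
  open Reflection in
  obtain ⟨hZm, hTm⟩ := hM.of_pair_mem hW hZM
  have hB := isTopologicalBasis_reflectedBase hT hW hM hZm
  refine ⟨hB, ?_⟩
  let _ := reflectedSpace Z T M
  have hωW := hW.omega_mem hM.subset hc ⟨_, hZM⟩
  have hnat := hM.natSet_mem hW hc ⟨_, hZM⟩
  have hωM : ZFSet.omega ∈ M := hM.range_mem hW hc hnat hωW fun _ => mem_omega
  let ω' : W := ⟨ZFSet.omega, hωW⟩
  let Z' : W := ⟨Z, hM.subset hZm⟩
  let T' : W := ⟨T, hM.subset hTm⟩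
  obtain ⟨R, hRM, hR⟩ := hM.exists_mem (α := Fin 3)
    (P := fun v R => HasNoConvergentSubsequence (v 0) (v 1) (v 2) R)
    (.hasNoConvergentSubsequence hW _ _ _ _) ![ω', Z', T']
    (by intro i; fin_cases i <;> assumption)
    (exists_hasNoConvergentSubsequence hW (Z := Z') (T := T') rfl hT hZ)
  replace hR : HasNoConvergentSubsequence ω' Z' T' R := hR
  intro hG
  obtain ⟨φ, hφ, hconv⟩ := hG fun n => {x | ZFSet.pair (natSet n) x.1 ∈ (R : ZFSet)}
  refine (not_kuratowskiConverges_iff hB _).2 ?_ hconv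
  -- The subsequence is coded by a set `A` that belongs to `M`, by countable closure.
  let A : ZFSet := ZFSet.sep (fun x => ∃ k, x = natSet (φ k)) ZFSet.omega
  have hA (x : ZFSet) : x ∈ A ↔ ∃ k, x = natSet (φ k) := by
    rw [ZFSet.mem_sep, and_iff_right_of_imp]
    rintro ⟨k, rfl⟩
    exact natSet_mem_omega _
  have hAω : A ⊆ ZFSet.omega := fun x hx => (ZFSet.mem_sep.1 hx).1
  have hAW : A ∈ W := hW.mem_of_subset hAω hωW
  have hAM : A ∈ M := hM.range_mem hW hc (fun k => hnat (φ k)) hAW hA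
  let A' : W := ⟨A, hAW⟩
  have hcof := (cofinal_iff_frequently hW (ω := ω') (A := A') rfl hφ hA fun _ => True).2
    (Frequently.of_forall fun _ => trivial)
  obtain ⟨x, hxM, hx⟩ := hM.exists_mem (α := Fin 5)
    (P := fun v x => IsDivergencePoint (v 0) (v 1) (v 2) (v 3) (v 4) x)
    (.isDivergencePoint hW _ _ _ _ _ _) ![ω', Z', T', R, A']
    (by intro i; fin_cases i <;> assumption)
    (hR A' (fun n hn => hAω hn) fun m hm => by simpa using hcof m hm)
  obtain ⟨hxZ, hmeet, hmiss⟩ : IsDivergencePoint ω' Z' T' R A' x := hx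
  refine ⟨⟨x, hxZ, hxM⟩, ?_, ?_⟩
  · rintro _ ⟨U, hU, hUM, rfl⟩ hxU
    have h := (cofinallyMeets_iff hW rfl hφ hA).1 (hmeet ⟨U, hM.subset hUM⟩ hU hxU)
    refine h.mono fun k hk => ?_
    let n' : W := ⟨natSet (φ k), hM.subset (hnat _)⟩
    -- By elementarity `U` meets the section of `R` at `φ k` in a point of `M`.
    obtain ⟨y, hyM, hyU, p, hp, hpy⟩ := hM.exists_mem (α := Fin 3)
      (P := fun v y => (y : ZFSet) ∈ (v 0 : ZFSet) ∧ ∃ p : W, (p : ZFSet) ∈ (v 1 : ZFSet) ∧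
        (p : ZFSet) = ZFSet.pair (v 2 : ZFSet) (y : ZFSet))
      (.and (.mem _ _) (.ex (.and (.mem _ _) (.eq_pair hW _ _ _))))
      ![⟨U, hM.subset hUM⟩, R, n']
      (by intro i; fin_cases i; exacts [hUM, hRM, hnat _])
      ((sectionMeets_iff hW (R := R) (n := n') (U := ⟨U, hM.subset hUM⟩)).2 hk)
    exact ⟨⟨y, hT.subset U hU hyU, hyM⟩, hyU, show ZFSet.pair (natSet (φ k)) y ∈ (R : ZFSet) from
      (show (p : ZFSet) = ZFSet.pair (natSet (φ k)) y from hpy) ▸ hp⟩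
  · -- The set that misses infinitely many terms is chosen in `M`.
    obtain ⟨U, hUM, hU, hxU, hUmiss⟩ := hM.exists_mem (α := Fin 5)
      (P := fun v U => (U : ZFSet) ∈ (v 0 : ZFSet) ∧ (v 1 : ZFSet) ∈ (U : ZFSet) ∧
        CofinallyMisses (v 2) (v 3) (v 4) U)
      (.and (.mem _ _) (.and (.mem _ _) (.cofinallyMisses hW _ _ _ _)))
      ![T', x, ω', R, A'] (by intro i; fin_cases i <;> assumption) hmiss
    have h := (cofinallyMisses_iff hW (ω := ω') (A := A') rfl hφ hA).1 hUmiss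
    refine ⟨_, ⟨U, hU, hUM, rfl⟩, hxU, h.mono fun k hk => ?_⟩
    rintro ⟨y, hyU, hy⟩
    exact hk ⟨y, hyU, hy⟩
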